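/- Let $K$ be a field, let $a,b,c\in K$ be such that the polynomial $g(x,y)=axy+b(x+y)+c$ is nonzero, let $n$ be a non-negative integer, and let $x_1,\dots,x_{2n}\in K$ satisfy $g(x_i,x_j)\neq 0$ for all $1\le i<j\le 2n$. Let $\mathcal F_{2n}$ be the set of permutations $\sigma$ of $\{1,\dots,2n\}$ with $\sigma(1)<\sigma(3)<\cdots<\sigma(2n-1)$ and $\sigma(2i-1)<\sigma(2i)$ for $1\le i\le n$. For a skew-symmetric $2n\times 2n$ matrix $A=(a_{ij})$ put $$\operatorname{Pf}A=\sum_{\sigma\in\mathcal F_{2n}}\operatorname{sgn}(\sigma)\,a_{\sigma(1)\sigma(2)}\cdots a_{\sigma(2n-1)\sigma(2n)},$$ and for a symmetric $2n\times 2n$ matrix $A=(a_{ij})$ put $$\operatorname{Hf}A=\sum_{\sigma\in\mathcal F_{2n}}a_{\sigma(1)\sigma(2)}\cdots a_{\sigma(2n-1)\sigma(2n)}$$ (these sums involve only the entries $a_{ij}$ with $i<j$). Then $$\operatorname{Pf}\left(\frac{x_j-x_i}{g(x_i,x_j)}\right)_{1\le i,j\le 2n}=(b^2-ac)^{n(n-1)}\prod_{1\le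 i<j\le 2n}\frac{x_j-x_i}{g(x_i,x_j)}$$ and $$\operatorname{Pf}\left(\frac{x_j-x_i}{g(x_i,x_j)^2}\right)_{1\le i,j\le 2n}=(b^2-ac)^{n(n-1)}\prod_{1\le i<j\le 2n}\frac{x_j-x_i}{g(x_i,x_j)}\cdot\operatorname{Hf}\left(\frac{1}{g(x_i,x_j)}\right)_{1\le i,j\le 2n}.$$ -/

import Mathlib

/-- The position `2i - 1` (for 1-based `i`) of `1, …, 2n`; 0-based it is `2 * i`. -/
def pairFst {n : ℕ} (i : Fin n) : Fin (2 * n) := ⟨2 * i.val, by omega⟩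

/-- The position `2i` (for 1-based `i`) of `1, …, 2n`; 0-based it is `2 * i + 1`. -/
def pairSnd {n : ℕ} (i : Fin n) : Fin (2 * n) := ⟨2 * i.val + 1, by omega⟩

/-- The set `𝓕₂ₙ` of all permutations `σ` of `1, …, 2n` such that
`σ(1) < σ(3) < ⋯ < σ(2n-1)` and `σ(2i-1) < σ(2i)` for `1 ≤ i ≤ n`. -/
def matchingPerms (n : ℕ) : Finset (Equiv.Perm (Fin (2 * n))) :=
  Finset.univ.filter fun σ =>
    (∀ i j : Fin n, i < j → σ (pairFst i) < σ (pairFst j)) ∧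
      ∀ i : Fin n, σ (pairFst i) < σ (pairSnd i)

/-- The Pfaffian of a `2n × 2n` skew-symmetric matrix, as a signed sum over `𝓕₂ₙ`
(only the entries above the diagonal are used). -/
def pfaffian {R : Type*} [CommRing R] {n : ℕ} (A : Matrix (Fin (2 * n)) (Fin (2 * n)) R) : R :=
  ∑ σ ∈ matchingPerms n,
    ((Equiv.Perm.sign σ : ℤ) : R) * ∏ i : Fin n, A (σ (pairFst i)) (σ (pairSnd i))

/-- The Hafnian of a `2n × 2n` symmetric matrix, as a sum over `𝓕₂ₙ`
(only the entries above the diagonal are used). -/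
def hafnian {R : Type*} [CommRing R] {n : ℕ} (A : Matrix (Fin (2 * n)) (Fin (2 * n)) R) : R :=
  ∑ σ ∈ matchingPerms n, ∏ i : Fin n, A (σ (pairFst i)) (σ (pairSnd i))

/-- The symmetric polynomial function `g(x, y) = a x y + b (x + y) + c`. -/
def gPoly {R : Type*} [CommRing R] (a b c x y : R) : R := a * x * y + b * (x + y) + c

/-! Put D = b² - ac and r(u, v) = g(u, v) / (v - u). This r is antisymmetric and satisfies the
cotangent law r(u,v) r(u,w) = D + r(u,v) r(v,w) + r(u,w) r(w,v) (`cotRatio_mul`), so products of its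
values expand in partial fractions with coefficients c_j = ∏_{k ≠ j} r(x_j, x_k).

Both identities follow by induction on n, expanding along the first row. Let y be the first point
and T the set of the other 2n + 1. Deleting j from the product of 1/r over the pairs of T multiplies
it by c_j, up to the sign (-1)^j of the expansion. The first identity thus becomes ∑ c_j / r(y, x_j)
= D^{2n} ∏ 1 / r(y, x_j), which is `tan_prod_eq_sum`. In the second, the j-th term carries the extra
weight H(T \ j) / g(y, x_j), where H is the Hafnian of 1/g. It is enough that the off-diagonal part
of (∑ c_k / r(y, x_k)) (∑ H(T \ j) / g(y, x_j)) vanishes. Times D, that part is a combination of the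
1 / g(y, x_p), and each coefficient is zero by `sum_residueCoeff_mul_cotRatio` and
`sum_recipHafnian_erase`.

This needs distinct points and, for the second identity, D ≠ 0. The general case is the constant
term of the identity for a deformation over K⟦X⟧. -/

/-! ### Partial fractions from the cotangent law -/

/-- The sequence `0, 1, 0, D, 0, D ^ 2, …`. -/
def oddPow {R : Type*} [CommRing R] (D : R) : ℕ → R
  | 0 => 0
  | 1 => 1
  | k + 2 => D * oddPow D k

theorem oddPow_even {R : Type*} [CommRing R] (D : R) (n : ℕ) : oddPow D (2 * n) = 0 := by
  induction n with
  | zero => rfl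
  | succ n ih => rw [show 2 * (n + 1) = 2 * n + 2 by ring, oddPow, ih, mul_zero]

/-- The residue-type coefficient `∏_{k ∈ T, k ≠ j} r j k`. -/
def residueCoeff {R ι : Type*} [CommRing R] [DecidableEq ι] (r : ι → ι → R) (T : Finset ι)
    (j : ι) : R := ∏ k ∈ T.erase j, r j k

/-- The addition law of the cotangent, for a function `v` on `T` relative to `r`. -/
def CotLaw {R ι : Type*} [CommRing R] (r : ι → ι → R) (D : R) (T : Finset ι) (v : ι → R) : Prop :=
  ∀ l ∈ T, ∀ j ∈ T, l ≠ j → v l * v j = D + v l * r l j + v j * r j l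

theorem CotLaw.mono {R ι : Type*} [CommRing R] {r : ι → ι → R} {D : R} {T U : Finset ι} {v : ι → R} (h : CotLaw r D U v) (hTU : T ⊆ U) :
    CotLaw r D T v := fun l hl j hj hlj => h l (hTU hl) j (hTU hj) hlj

section Cot

variable {R ι : Type*} [CommRing R] [DecidableEq ι] {r : ι → ι → R} {D : R}

theorem residueCoeff_insert_self {T : Finset ι} {l : ι} (hl : l ∉ T) :
    residueCoeff r (insert l T) l = ∏ k ∈ T, r l k := by
  rw [residueCoeff, Finset.erase_insert hl]

theorem residueCoeff_insert_of_mem {T : Finset ι} {l j : ι} (hl : l ∉ T) (hj : j ∈ T) :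
    residueCoeff r (insert l T) j = r j l * residueCoeff r T j := by
  have hjl : j ≠ l := fun h => hl (h ▸ hj)
  rw [residueCoeff, residueCoeff, Finset.erase_insert_of_ne hjl.symm, Finset.prod_insert]
  exact fun h => hl (Finset.mem_of_mem_erase h)

theorem sum_mul_residueCoeff_insert {T : Finset ι} {l : ι} (hl : l ∉ T) (v : ι → R) :
    ∑ j ∈ insert l T, v j * residueCoeff r (insert l T) j =
      v l * ∏ k ∈ T, r l k + ∑ j ∈ T, v j * (r j l * residueCoeff r T j) := by
  rw [Finset.sum_insert hl, residueCoeff_insert_self hl]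
  congr 1
  exact Finset.sum_congr rfl fun j hj => by rw [residueCoeff_insert_of_mem hl hj]

/-- The two claims need each other. Multiplying the expansion on `T` by `v l` and applying the law
termwise produces `D * ∑ residueCoeff`, while the coefficient sum on `insert l T` is governed by the
expansion on `T` at `v = r l`. -/
theorem cot_expansion_aux (ha : ∀ i j, r i j = -r j i)
    (hr : ∀ i, ∀ T : Finset ι, i ∉ T → CotLaw r D T (r i)) (T : Finset ι) :
    (∀ v, CotLaw r D T v →
      ∏ k ∈ T, v k = ∑ j ∈ T, v j * residueCoeff r T j + oddPow D (T.card + 1)) ∧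
    ∑ j ∈ T, residueCoeff r T j = oddPow D T.card := by
  induction T using Finset.induction_on with
  | empty => simp [oddPow]
  | insert l T hl ih =>
    obtain ⟨ih1, ih2⟩ := ih
    have hL := ih1 (r l) (hr l T hl)
    rw [Finset.card_insert_of_notMem hl]
    refine ⟨fun v hv => ?_, ?_⟩
    · have hV := ih1 v (hv.mono (Finset.subset_insert _ _))
      have key : ∀ j ∈ T, v l * (v j * residueCoeff r T j) =
          D * residueCoeff r T j + v l * (r l j * residueCoeff r T j) +
            v j * (r j l * residueCoeff r T j) := by
        intro j hj
        have := hv l (Finset.mem_insert_self _ _) j (Finset.mem_insert_of_mem hj)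
          (fun h => hl (h ▸ hj))
        linear_combination residueCoeff r T j * this
      have key' := Finset.sum_congr rfl key
      rw [Finset.sum_add_distrib, Finset.sum_add_distrib, ← Finset.mul_sum, ← Finset.mul_sum,
        ← Finset.mul_sum, ih2] at key'
      rw [Finset.prod_insert hl, sum_mul_residueCoeff_insert hl, oddPow, hV]
      linear_combination key' - v l * hL
    · have h1 := sum_mul_residueCoeff_insert (r := r) hl (fun _ => (1 : R))
      simp only [one_mul] at h1
      have h2 : ∑ j ∈ T, r j l * residueCoeff r T j = -∑ j ∈ T, r l j * residueCoeff r T j := by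
        rw [← Finset.sum_neg_distrib]
        exact Finset.sum_congr rfl fun j _ => by rw [ha j l]; ring
      rw [h1, h2, hL]
      ring

theorem cot_prod_eq_sum (ha : ∀ i j, r i j = -r j i)
    (hr : ∀ i, ∀ T : Finset ι, i ∉ T → CotLaw r D T (r i)) {T : Finset ι} {v : ι → R}
    (hv : CotLaw r D T v) :
    ∏ k ∈ T, v k = ∑ j ∈ T, v j * residueCoeff r T j + oddPow D (T.card + 1) :=
  (cot_expansion_aux ha hr T).1 v hv

theorem sum_residueCoeff (ha : ∀ i j, r i j = -r j i)
    (hr : ∀ i, ∀ T : Finset ι, i ∉ T → CotLaw r D T (r i)) (T : Finset ι) :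
    ∑ j ∈ T, residueCoeff r T j = oddPow D T.card :=
  (cot_expansion_aux ha hr T).2

/-- The hypothesis on `v` is the cotangent law for reciprocals. For an odd number of points `n` is
even and the correction `oddPow D n` disappears. -/
theorem tan_prod_eq_sum (ha : ∀ i j, r i j = -r j i)
    (hr : ∀ i, ∀ T : Finset ι, i ∉ T → CotLaw r D T (r i)) {v : ι → R}
    (hv : ∀ l j, l ≠ j → D * (v l * v j) = 1 + v l * r l j + v j * r j l)
    (n : ℕ) (T : Finset ι) (hT : T.card = n + 1) :
    D ^ n * ∏ k ∈ T, v k = ∑ j ∈ T, v j * residueCoeff r T j + oddPow D n := by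
  induction n generalizing T with
  | zero =>
    obtain ⟨l, rfl⟩ := Finset.card_eq_one.1 hT
    simp [residueCoeff, oddPow]
  | succ n ih =>
    obtain ⟨l, T, hl, rfl, hc⟩ := Finset.card_eq_succ.1 hT
    have hT' := ih T hc
    have hL := cot_prod_eq_sum ha hr (hr l T hl)
    have key : ∀ j ∈ T, D * v l * (v j * residueCoeff r T j) =
        residueCoeff r T j + v l * (r l j * residueCoeff r T j) +
          v j * (r j l * residueCoeff r T j) := by
      intro j hj
      linear_combination residueCoeff r T j * hv l j (fun h => hl (h ▸ hj))
    have key' := Finset.sum_congr rfl key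
    rw [Finset.sum_add_distrib, Finset.sum_add_distrib, ← Finset.mul_sum, ← Finset.mul_sum,
      sum_residueCoeff ha hr, hc] at key'
    rw [hc, oddPow] at hL
    rw [Finset.prod_insert hl, sum_mul_residueCoeff_insert hl]
    linear_combination key' + D * v l * hT' - v l * hL

/-- The derivative of `cot_prod_eq_sum`. -/
theorem sum_sq_mul_residueCoeff (ha : ∀ i j, r i j = -r j i)
    (hr : ∀ i, ∀ T : Finset ι, i ∉ T → CotLaw r D T (r i)) {v w : ι → R}
    (T : Finset ι) (hv : CotLaw r D T v) (hw : ∀ k ∈ T, v k * w k = 1) :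
    ∑ j ∈ T, v j ^ 2 * residueCoeff r T j =
      D * oddPow D T.card + (∏ k ∈ T, v k) * ∑ k ∈ T, (v k - D * w k) := by
  induction T using Finset.induction_on with
  | empty => simp [oddPow]
  | insert l T hl ih =>
    have hvT := hv.mono (Finset.subset_insert l T)
    have ih' := ih hvT fun k hk => hw k (Finset.mem_insert_of_mem hk)
    have hL := cot_prod_eq_sum ha hr (hr l T hl)
    have hV := cot_prod_eq_sum ha hr hvT
    have hS := sum_residueCoeff ha hr T
    -- The law for `l`, `j` is used twice: multiplied by `v j` it lowers the square, and then it
    -- removes the remaining product `v j * r l j`.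
    have key : ∀ j ∈ T, v j ^ 2 * (r j l * residueCoeff r T j) =
        v l * (v j ^ 2 * residueCoeff r T j) - D * (v j * residueCoeff r T j) -
          v l * (D * residueCoeff r T j + v l * (r l j * residueCoeff r T j) -
            v l * (v j * residueCoeff r T j)) := by
      intro j hj
      have h1 := hv l (Finset.mem_insert_self _ _) j (Finset.mem_insert_of_mem hj)
        (fun h => hl (h ▸ hj))
      have h2 := ha j l
      linear_combination (-v j * residueCoeff r T j) * h1
        - v l * residueCoeff r T j * h1 - (v l * v j * residueCoeff r T j) * h2
    have key' := Finset.sum_congr rfl key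
    rw [Finset.sum_sub_distrib, Finset.sum_sub_distrib, ← Finset.mul_sum, ← Finset.mul_sum,
      ← Finset.mul_sum, Finset.sum_sub_distrib, Finset.sum_add_distrib, ← Finset.mul_sum,
      ← Finset.mul_sum, ← Finset.mul_sum] at key'
    have hwl := hw l (Finset.mem_insert_self _ _)
    rw [sum_mul_residueCoeff_insert hl, Finset.card_insert_of_notMem hl, Finset.prod_insert hl,
      Finset.sum_insert hl, key', ih', hS]
    linear_combination D * hV - v l ^ 2 * hV + v l ^ 2 * hL + D * (∏ k ∈ T, v k) * hwl

end Cot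

/-! ### Hafnians over finite index sets -/

/-- The Hafnian of the restriction of `w` to `S`, for `#S = 2 * n`, by expansion along the
least element. -/
def finsetHafnian {R ι : Type*} [CommRing R] [LinearOrder ι] (w : ι → ι → R) :
    ℕ → Finset ι → R
  | 0, _ => 1
  | n + 1, S => if h : S.Nonempty then
      ∑ j ∈ S.erase (S.min' h), w (S.min' h) j * finsetHafnian w n ((S.erase (S.min' h)).erase j)
      else 0

/-- Expanding along the least element `m` and then `p`, or along `p` and then `m`, gives the same
double sum over the partners of `m` and `p`; the terms pairing `m` with `p` agree separately. -/
theorem finsetHafnian_succ {R ι : Type*} [CommRing R] [LinearOrder ι] {w : ι → ι → R}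
    (hw : ∀ i j, w i j = w j i) (n : ℕ) (S : Finset ι) (hS : S.card = 2 * (n + 1)) (p : ι)
    (hp : p ∈ S) :
    finsetHafnian w (n + 1) S =
      ∑ j ∈ S.erase p, w p j * finsetHafnian w n ((S.erase p).erase j) := by
  induction n generalizing S p with
  | zero =>
    obtain ⟨x, y, hxy, rfl⟩ := Finset.card_eq_two.1 hS
    have h : ({x, y} : Finset ι).Nonempty := ⟨x, by simp⟩
    have hm := Finset.min'_mem _ h
    rw [finsetHafnian, dif_pos h]
    generalize Finset.min' {x, y} h = m at hm
    have e1 : ({x, y} : Finset ι).erase x = {y} := by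
      ext z; simp only [Finset.mem_erase, Finset.mem_insert, Finset.mem_singleton]; grind
    have e2 : ({x, y} : Finset ι).erase y = {x} := by
      ext z; simp only [Finset.mem_erase, Finset.mem_insert, Finset.mem_singleton]; grind
    simp only [Finset.mem_insert, Finset.mem_singleton] at hm hp
    rcases hm with rfl | rfl <;> rcases hp with rfl | rfl <;>
      simp [e1, e2, finsetHafnian] <;> exact hw _ _
  | succ n ih =>
    have h : S.Nonempty := ⟨p, hp⟩
    have hm := Finset.min'_mem _ h
    rw [finsetHafnian, dif_pos h]
    generalize Finset.min' S h = m at hm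
    rcases eq_or_ne m p with rfl | hmp
    · rfl
    have hpm : p ∈ S.erase m := Finset.mem_erase.2 ⟨hmp.symm, hp⟩
    have hmp' : m ∈ S.erase p := Finset.mem_erase.2 ⟨hmp, hm⟩
    rw [← Finset.add_sum_erase _ _ hpm, ← Finset.add_sum_erase _ _ hmp']
    congr 1
    · rw [hw, Finset.erase_right_comm]
    have hcard : ∀ a b : ι, a ∈ S → b ∈ S.erase a → ((S.erase a).erase b).card = 2 * (n + 1) := by
      intro a b ha hb
      rw [Finset.card_erase_of_mem hb, Finset.card_erase_of_mem ha, hS]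
      omega
    have h1 : ∀ j ∈ (S.erase m).erase p,
        w m j * finsetHafnian w (n + 1) ((S.erase m).erase j) =
        ∑ l ∈ ((S.erase m).erase p).erase j, w m j * w p l *
          finsetHafnian w n ((((S.erase m).erase p).erase j).erase l) := by
      intro j hj
      have hj' := Finset.mem_of_mem_erase hj
      rw [ih _ (hcard m j hm hj') p (Finset.mem_erase.2 ⟨(Finset.ne_of_mem_erase hj).symm, hpm⟩),
        Finset.mul_sum, Finset.erase_right_comm]
      exact Finset.sum_congr rfl fun l _ => by ring
    have h2 : ∀ l ∈ (S.erase p).erase m,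
        w p l * finsetHafnian w (n + 1) ((S.erase p).erase l) =
        ∑ j ∈ ((S.erase m).erase p).erase l, w m j * w p l *
          finsetHafnian w n ((((S.erase m).erase p).erase j).erase l) := by
      intro j hj
      have hj' := Finset.mem_of_mem_erase hj
      rw [ih _ (hcard p j hp hj') m (Finset.mem_erase.2 ⟨(Finset.ne_of_mem_erase hj).symm, hmp'⟩),
        Finset.mul_sum, Finset.erase_right_comm (a := j) (b := m),
        Finset.erase_right_comm (a := p) (b := m)]
      refine Finset.sum_congr rfl fun l _ => ?_
      rw [Finset.erase_right_comm (a := l)]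
      ring
    rw [Finset.sum_congr rfl h1, Finset.sum_congr rfl h2, Finset.erase_right_comm (a := p)]
    refine Finset.sum_comm' fun j l => ?_
    simp only [Finset.mem_erase]
    grind

/-! ### First-row expansion of Pfaffians and Hafnians -/

/-- The permutation of `0, …, 2n + 1` that fixes `0`, sends `1` to `j + 1`, and acts on the
remaining elements like `ρ`. -/
def consPairPerm {n : ℕ} (j : Fin (2 * n + 1)) (ρ : Equiv.Perm (Fin (2 * n))) :
    Equiv.Perm (Fin (2 * (n + 1))) :=
  Equiv.Perm.decomposeFin.symm (0, j.cycleRange.symm * Equiv.Perm.decomposeFin.symm (0, ρ))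

section

variable {n : ℕ}

theorem pairFst_zero : pairFst (0 : Fin (n + 1)) = (0 : Fin (2 * n + 1 + 1)) := rfl

theorem pairSnd_zero : pairSnd (0 : Fin (n + 1)) = (0 : Fin (2 * n + 1)).succ := rfl

theorem pairFst_succ (i : Fin n) :
    pairFst i.succ = ((pairFst i).succ.succ : Fin (2 * n + 1 + 1)) := rfl

theorem pairSnd_succ (i : Fin n) :
    pairSnd i.succ = ((pairSnd i).succ.succ : Fin (2 * n + 1 + 1)) := rfl

variable (j : Fin (2 * n + 1)) (ρ : Equiv.Perm (Fin (2 * n)))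

theorem consPairPerm_zero : consPairPerm j ρ (0 : Fin (2 * n + 1 + 1)) =
    (0 : Fin (2 * n + 1 + 1)) :=
  Equiv.Perm.decomposeFin_symm_apply_zero _ _

theorem consPairPerm_one :
    consPairPerm j ρ (Fin.succ (0 : Fin (2 * n + 1))) = (j.succ : Fin (2 * n + 1 + 1)) := by
  refine (Equiv.Perm.decomposeFin_symm_apply_succ _ _ _).trans ?_
  rw [Equiv.Perm.mul_apply, Equiv.Perm.decomposeFin_symm_apply_zero]
  simp

theorem consPairPerm_succ_succ (k : Fin (2 * n)) :
    consPairPerm j ρ (k.succ.succ : Fin (2 * n + 1 + 1)) =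
      ((j.succAbove (ρ k)).succ : Fin (2 * n + 1 + 1)) := by
  refine (Equiv.Perm.decomposeFin_symm_apply_succ _ _ _).trans ?_
  rw [Equiv.Perm.mul_apply, Equiv.Perm.decomposeFin_symm_apply_succ]
  simp

theorem sign_consPairPerm :
    Equiv.Perm.sign (consPairPerm j ρ) = (-1) ^ (j : ℕ) * Equiv.Perm.sign ρ := by
  refine (Equiv.Perm.decomposeFin.symm_sign _ _).trans ?_
  rw [Equiv.Perm.sign_mul, Equiv.Perm.decomposeFin.symm_sign, Equiv.Perm.sign_symm,
    Fin.sign_cycleRange]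
  simp

theorem consPairPerm_mem : consPairPerm j ρ ∈ matchingPerms (n + 1) ↔ ρ ∈ matchingPerms n := by
  simp only [matchingPerms, Finset.mem_filter, Finset.mem_univ, true_and]
  have hs : ∀ i i' : Fin n, consPairPerm j ρ (pairFst i.succ) < consPairPerm j ρ (pairFst i'.succ) ↔
      ρ (pairFst i) < ρ (pairFst i') := by
    intro i i'
    rw [pairFst_succ, pairFst_succ, consPairPerm_succ_succ, consPairPerm_succ_succ]
    exact Fin.succ_lt_succ_iff.trans (Fin.strictMono_succAbove j).lt_iff_lt
  have hs' : ∀ i : Fin n, consPairPerm j ρ (pairFst i.succ) < consPairPerm j ρ (pairSnd i.succ) ↔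
      ρ (pairFst i) < ρ (pairSnd i) := by
    intro i
    rw [pairFst_succ, pairSnd_succ, consPairPerm_succ_succ, consPairPerm_succ_succ]
    exact Fin.succ_lt_succ_iff.trans (Fin.strictMono_succAbove j).lt_iff_lt
  constructor
  · rintro ⟨h1, h2⟩
    exact ⟨fun i i' h => (hs i i').1 (h1 _ _ (Fin.succ_lt_succ_iff.2 h)),
      fun i => (hs' i).1 (h2 _)⟩
  · rintro ⟨h1, h2⟩
    refine ⟨fun i i' h => ?_, fun i => ?_⟩
    · induction i' using Fin.cases with
      | zero => exact absurd h (Fin.not_lt_zero _)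
      | succ i' =>
        induction i using Fin.cases with
        | zero =>
          rw [pairFst_zero, pairFst_succ, consPairPerm_zero, consPairPerm_succ_succ]
          exact Fin.succ_pos _
        | succ i => exact (hs i i').2 (h1 _ _ (Fin.succ_lt_succ_iff.1 h))
    · induction i using Fin.cases with
      | zero =>
        rw [pairFst_zero, pairSnd_zero, consPairPerm_zero, consPairPerm_one]
        exact Fin.succ_pos _
      | succ i => exact (hs' i).2 (h2 i)

end

theorem exists_decomposeFin_symm_zero {m : ℕ} (σ : Equiv.Perm (Fin (m + 1))) (h : σ 0 = 0) :
    ∃ ρ, Equiv.Perm.decomposeFin.symm (0, ρ) = σ := by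
  obtain ⟨⟨p, ρ⟩, rfl⟩ := Equiv.Perm.decomposeFin.symm.surjective σ
  rw [Equiv.Perm.decomposeFin_symm_apply_zero] at h
  exact ⟨ρ, by rw [h]⟩

/-- Each position is the first or second of some pair, so its value is at least that of a first
position, hence at least the value at position 0. -/
theorem apply_zero_of_mem_matchingPerms {n : ℕ} {σ : Equiv.Perm (Fin (2 * (n + 1)))}
    (hσ : σ ∈ matchingPerms (n + 1)) : σ (0 : Fin (2 * n + 1 + 1)) = (0 : Fin (2 * n + 1 + 1)) := by
  simp only [matchingPerms, Finset.mem_filter, Finset.mem_univ, true_and] at hσ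
  obtain ⟨h1, h2⟩ := hσ
  have hmin : ∀ i : Fin (n + 1), σ (pairFst 0) ≤ σ (pairFst i) := by
    intro i
    rcases (Fin.zero_le i).eq_or_lt with h | h
    · rw [h]
    · exact (h1 _ _ h).le
  obtain ⟨k, hk⟩ := σ.surjective (0 : Fin (2 * n + 1 + 1))
  have hle : σ (pairFst 0) ≤ σ k := by
    rcases Nat.even_or_odd' k.val with ⟨i, hi | hi⟩
    · have : k = pairFst ⟨i, by have := k.isLt; omega⟩ := Fin.ext hi
      rw [this]
      exact hmin _
    · have : k = pairSnd ⟨i, by have := k.isLt; omega⟩ := Fin.ext hi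
      rw [this]
      exact (hmin _).trans (h2 _).le
  rw [hk] at hle
  exact Fin.le_zero_iff.1 hle

theorem sum_matchingPerms_succ {M : Type*} [AddCommMonoid M] {n : ℕ}
    (f : Equiv.Perm (Fin (2 * (n + 1))) → M) :
    ∑ σ ∈ matchingPerms (n + 1), f σ =
      ∑ j : Fin (2 * n + 1), ∑ ρ ∈ matchingPerms n, f (consPairPerm j ρ) := by
  rw [← Finset.sum_product']
  symm
  refine Finset.sum_nbij (fun q => consPairPerm q.1 q.2) ?_ ?_ ?_ fun _ _ => rfl
  · rintro ⟨j, ρ⟩ h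
    exact (consPairPerm_mem j ρ).2 (Finset.mem_product.1 h).2
  · rintro ⟨j, ρ⟩ - ⟨j', ρ'⟩ - h
    have h1 := (Prod.ext_iff.1 (Equiv.Perm.decomposeFin.symm.injective h)).2
    have hj : j = j' := by
      have := congrArg (fun τ : Equiv.Perm (Fin (2 * n + 1)) => τ 0) h1
      simpa using this
    subst hj
    have h2 := Equiv.Perm.decomposeFin.symm.injective (mul_left_cancel h1)
    exact Prod.ext rfl (Prod.ext_iff.1 h2).2
  · intro σ hσ
    obtain ⟨τ, hτ⟩ := exists_decomposeFin_symm_zero (m := 2 * n + 1) σ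
      (apply_zero_of_mem_matchingPerms hσ)
    obtain ⟨ρ, hρ⟩ := exists_decomposeFin_symm_zero ((τ 0).cycleRange * τ) (by simp)
    have hc : consPairPerm (τ 0) ρ = σ := by
      rw [consPairPerm, hρ, ← hτ]
      congr 2
      ext k
      simp
    refine ⟨(τ 0, ρ), ?_, hc⟩
    refine Finset.mem_product.2 ⟨Finset.mem_univ _, ?_⟩
    exact (consPairPerm_mem (τ 0) ρ).1 (hc ▸ hσ)

section

variable {R : Type*} [CommRing R] {n : ℕ}

theorem prod_consPairPerm (A : Matrix (Fin (2 * (n + 1))) (Fin (2 * (n + 1))) R)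
    (j : Fin (2 * n + 1)) (ρ : Equiv.Perm (Fin (2 * n))) :
    ∏ i : Fin (n + 1), A (consPairPerm j ρ (pairFst i)) (consPairPerm j ρ (pairSnd i)) =
      A (0 : Fin (2 * n + 1 + 1)) j.succ *
        ∏ i : Fin n, A (j.succAbove (ρ (pairFst i))).succ (j.succAbove (ρ (pairSnd i))).succ := by
  rw [Fin.prod_univ_succ, pairFst_zero, pairSnd_zero, consPairPerm_zero, consPairPerm_one]
  congr 1
  refine Finset.prod_congr rfl fun i _ => ?_
  rw [pairFst_succ, pairSnd_succ, consPairPerm_succ_succ, consPairPerm_succ_succ]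

theorem pfaffian_succ (A : Matrix (Fin (2 * (n + 1))) (Fin (2 * (n + 1))) R) :
    pfaffian A = ∑ j : Fin (2 * n + 1), (-1) ^ (j : ℕ) * A (0 : Fin (2 * n + 1 + 1)) j.succ *
      pfaffian (Matrix.of fun k l => A (j.succAbove k).succ (j.succAbove l).succ) := by
  rw [pfaffian, sum_matchingPerms_succ]
  refine Finset.sum_congr rfl fun j _ => ?_
  rw [pfaffian, Finset.mul_sum]
  refine Finset.sum_congr rfl fun ρ _ => ?_
  rw [prod_consPairPerm, sign_consPairPerm]
  simp only [Matrix.of_apply, Units.val_mul, Units.val_pow_eq_pow_val, Units.val_neg,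
    Units.val_one, Int.cast_mul, Int.cast_pow, Int.cast_neg, Int.cast_one]
  ring

theorem hafnian_succ (A : Matrix (Fin (2 * (n + 1))) (Fin (2 * (n + 1))) R) :
    hafnian A = ∑ j : Fin (2 * n + 1), A (0 : Fin (2 * n + 1 + 1)) j.succ *
      hafnian (Matrix.of fun k l => A (j.succAbove k).succ (j.succAbove l).succ) := by
  rw [hafnian, sum_matchingPerms_succ]
  refine Finset.sum_congr rfl fun j _ => ?_
  rw [hafnian, Finset.mul_sum]
  refine Finset.sum_congr rfl fun ρ _ => ?_
  rw [prod_consPairPerm]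
  rfl

theorem pfaffian_zero (A : Matrix (Fin (2 * 0)) (Fin (2 * 0)) R) : pfaffian A = 1 := by
  have : matchingPerms 0 = {1} := by decide
  simp [pfaffian, this]

theorem hafnian_zero (A : Matrix (Fin (2 * 0)) (Fin (2 * 0)) R) : hafnian A = 1 := by
  have : matchingPerms 0 = {1} := by decide
  simp [hafnian, this]

/-- Ignoring the diagonal is essential in the final descent, where g(x_i, x_i) may vanish and
inverses of power series need not map to inverses. -/
theorem pfaffian_congr {A B : Matrix (Fin (2 * n)) (Fin (2 * n)) R}
    (h : ∀ i j, i < j → A i j = B i j) : pfaffian A = pfaffian B := by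
  refine Finset.sum_congr rfl fun σ hσ => ?_
  congr 1
  exact Finset.prod_congr rfl fun i _ => h _ _ ((Finset.mem_filter.1 hσ).2.2 i)

theorem hafnian_congr {A B : Matrix (Fin (2 * n)) (Fin (2 * n)) R}
    (h : ∀ i j, i < j → A i j = B i j) : hafnian A = hafnian B := by
  refine Finset.sum_congr rfl fun σ hσ => ?_
  exact Finset.prod_congr rfl fun i _ => h _ _ ((Finset.mem_filter.1 hσ).2.2 i)

theorem map_pfaffian {S : Type*} [CommRing S] (f : R →+* S)
    (A : Matrix (Fin (2 * n)) (Fin (2 * n)) R) : f (pfaffian A) = pfaffian (A.map f) := by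
  simp [pfaffian, map_sum, map_prod]

theorem map_hafnian {S : Type*} [CommRing S] (f : R →+* S)
    (A : Matrix (Fin (2 * n)) (Fin (2 * n)) R) : f (hafnian A) = hafnian (A.map f) := by
  simp [hafnian, map_sum, map_prod]

theorem hafnian_of_strictMono {ι : Type*} [LinearOrder ι] (w : ι → ι → R)
    (e : Fin (2 * n) → ι) (he : StrictMono e) :
    hafnian (Matrix.of fun i j => w (e i) (e j)) =
      finsetHafnian w n (Finset.univ.image e) := by
  induction n with
  | zero => rw [hafnian_zero, finsetHafnian]
  | succ n ih =>
    have herase : ∀ {m : ℕ} (f : Fin (m + 1) → ι), StrictMono f → ∀ j : Fin (m + 1),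
        (Finset.univ.image f).erase (f j) = Finset.univ.image fun k => f (j.succAbove k) := by
      intro m f hf j
      rw [← Finset.image_erase hf.injective, ← Finset.compl_singleton,
        ← Fin.image_succAbove_univ, Finset.image_image, Function.comp_def]
    have h : (Finset.univ.image e).Nonempty := ⟨e (0 : Fin (2 * n + 1 + 1)), by simp⟩
    have hmin : (Finset.univ.image e).min' h = e (0 : Fin (2 * n + 1 + 1)) := by
      refine le_antisymm (Finset.min'_le _ _ (by simp)) (Finset.le_min' _ _ _ ?_)
      intro y hy
      obtain ⟨k, -, rfl⟩ := Finset.mem_image.1 hy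
      exact he.monotone (Fin.zero_le (n := 2 * n + 1 + 1) k)
    have he' : StrictMono fun k : Fin (2 * n + 1) => e (k.succ : Fin (2 * n + 1 + 1)) :=
      fun a b hab => he (Fin.succ_lt_succ_iff.2 hab)
    have hS : (Finset.univ.image e).erase (e (0 : Fin (2 * n + 1 + 1))) =
        Finset.univ.image fun k : Fin (2 * n + 1) => e (k.succ : Fin (2 * n + 1 + 1)) :=
      (herase (m := 2 * n + 1) e he 0).trans (by simp only [Fin.succAbove_zero])
    rw [hafnian_succ, finsetHafnian, dif_pos h, hmin, hS,
      Finset.sum_image fun _ _ _ _ h => he'.injective h]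
    refine Finset.sum_congr rfl fun j _ => ?_
    rw [herase (fun k : Fin (2 * n + 1) => e (k.succ : Fin (2 * n + 1 + 1))) he' j]
    exact congrArg (w (e (0 : Fin (2 * n + 1 + 1))) (e (j.succ : Fin (2 * n + 1 + 1))) * ·)
      (ih _ (he'.comp (Fin.strictMono_succAbove j)))

end

/-- Splitting the index `p` off a product over all pairs `i < k`. -/
theorem prod_prod_Ioi_succAbove {R : Type*} [CommRing R] {m : ℕ} (s : Fin (m + 1) → Fin (m + 1) → R)
    (hs : ∀ i j, s i j = -s j i) (p : Fin (m + 1)) :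
    ∏ i, ∏ k ∈ Finset.Ioi i, s i k =
      (-1) ^ (p : ℕ) * (∏ k ∈ Finset.univ.erase p, s p k) *
        ∏ i, ∏ k ∈ Finset.Ioi i, s (p.succAbove i) (p.succAbove k) := by
  have hI : ∀ {l : ℕ} (f : Fin l → Fin l → R), ∏ i, ∏ k ∈ Finset.Ioi i, f i k =
      ∏ i, ∏ k, if i < k then f i k else 1 := by
    intro l f
    refine Finset.prod_congr rfl fun i _ => ?_
    rw [← Finset.prod_filter]
    congr 1
    ext k
    simp
  have hE : ∏ k ∈ Finset.univ.erase p, s p k = ∏ k, s p (p.succAbove k) := by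
    rw [Finset.erase_eq, Finset.sdiff_singleton_eq_erase, ← Finset.compl_singleton,
      ← Fin.image_succAbove_univ, Finset.prod_image]
    exact fun _ _ _ _ h => Fin.succAbove_right_injective h
  -- The pairs whose orientation is reversed are those with smaller index below `p`; there are `p`
  -- of them.
  have hc : ∏ k : Fin m, (if p.succAbove k < p then (-1 : R) else 1) = (-1) ^ (p : ℕ) := by
    rw [Finset.prod_ite, Finset.prod_const_one, mul_one, Finset.prod_const]
    congr 1
    have : (Finset.univ.filter fun k : Fin m => p.succAbove k < p) =
        Finset.univ.filter fun k : Fin m => (k : ℕ) < p := by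
      ext k
      rw [Finset.mem_filter, Finset.mem_filter, Fin.succAbove_lt_iff_castSucc_lt]
      rfl
    rw [this, Fin.card_filter_val_lt, min_eq_right (Nat.lt_succ_iff.1 p.isLt)]
  rw [hI, hI, hE, ← hc, Fin.prod_univ_succAbove _ p, Fin.prod_univ_succAbove _ p,
    if_neg (lt_irrefl p), one_mul]
  simp only [Fin.prod_univ_succAbove _ p, Finset.prod_mul_distrib,
    (Fin.strictMono_succAbove p).lt_iff_lt]
  rw [← mul_assoc]
  congr 1
  rw [← Finset.prod_mul_distrib, ← Finset.prod_mul_distrib]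
  refine Finset.prod_congr rfl fun k _ => ?_
  rcases lt_or_gt_of_ne (Fin.succAbove_ne p k) with h | h
  · simp [h, h.not_gt, hs p]
  · simp [h, h.not_gt]

/-! ### Identities for the ratios g(u, v) / (v - u) -/

section Field

variable {F : Type*} [Field F] (a b c : F)

theorem gPoly_comm (u v : F) : gPoly a b c u v = gPoly a b c v u := by
  simp only [gPoly]; ring

/-- The quotient `g(u, v) / (v - u)`. -/
def cotRatio (u v : F) : F := gPoly a b c u v / (v - u)

theorem cotRatio_antisymm (u v : F) : cotRatio a b c u v = -cotRatio a b c v u := by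
  rw [cotRatio, cotRatio, gPoly_comm, ← neg_sub v u, div_neg, neg_neg]

theorem cotRatio_mul {u v w : F} (huv : u ≠ v) (huw : u ≠ w) (hvw : v ≠ w) :
    cotRatio a b c u v * cotRatio a b c u w = (b ^ 2 - a * c) +
      cotRatio a b c u v * cotRatio a b c v w + cotRatio a b c u w * cotRatio a b c w v := by
  have h1 := sub_ne_zero.2 huv.symm
  have h2 := sub_ne_zero.2 huw.symm
  have h3 := sub_ne_zero.2 hvw.symm
  have h4 := sub_ne_zero.2 hvw
  simp only [cotRatio, gPoly]
  rw [← neg_sub w v, div_neg]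
  field_simp
  ring

/-- This is `cotRatio_mul` divided by the two factors containing `u`; in this form `u` may coincide
with `v` or `w`. -/
theorem tanRatio_mul {u v w : F} (huv : gPoly a b c u v ≠ 0) (huw : gPoly a b c u w ≠ 0)
    (hvw : v ≠ w) :
    (b ^ 2 - a * c) * ((v - u) / gPoly a b c u v * ((w - u) / gPoly a b c u w)) =
      1 + (v - u) / gPoly a b c u v * cotRatio a b c v w +
        (w - u) / gPoly a b c u w * cotRatio a b c w v := by
  have h3 := sub_ne_zero.2 hvw.symm
  rw [cotRatio_antisymm a b c w v, cotRatio]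
  field_simp
  simp only [gPoly]
  ring

theorem cotLaw_cotRatio {ι : Type*} (x : ι → F) (hx : Function.Injective x) (i : ι)
    (T : Finset ι) (hi : i ∉ T) :
    CotLaw (fun i j => cotRatio a b c (x i) (x j)) (b ^ 2 - a * c) T
      fun j => cotRatio a b c (x i) (x j) := fun _ hl _ hj hlj =>
  cotRatio_mul a b c (hx.ne fun h => hi (h ▸ hl)) (hx.ne fun h => hi (h ▸ hj)) (hx.ne hlj)

variable {ι : Type*} [LinearOrder ι] (x : ι → F)

/-- The Hafnian of `1 / g(x i, x j)` over a finite set of indices. -/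
def recipHafnian (n : ℕ) (T : Finset ι) : F :=
  finsetHafnian (fun i j => 1 / gPoly a b c (x i) (x j)) n T

theorem recipHafnian_succ (n : ℕ) (S : Finset ι) (hS : S.card = 2 * (n + 1)) (p : ι)
    (hp : p ∈ S) : recipHafnian a b c x (n + 1) S = ∑ j ∈ S.erase p,
      1 / gPoly a b c (x p) (x j) * recipHafnian a b c x n ((S.erase p).erase j) :=
  finsetHafnian_succ (fun i j => by rw [gPoly_comm]) n S hS p hp

variable {x}

/-- Expand `T.erase j` along `p` and `T.erase p` along `j`. The summand becomes (x_j - x_l) times a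
function symmetric in j and l, so the double sum cancels. -/
theorem sum_recipHafnian_erase (hx : Function.Injective x)
    (hg : ∀ i j, i ≠ j → gPoly a b c (x i) (x j) ≠ 0) (n : ℕ) (T : Finset ι)
    (hT : T.card = 2 * n + 1) (p : ι) (hp : p ∈ T) :
    ∑ j ∈ T.erase p, (recipHafnian a b c x n (T.erase j) - recipHafnian a b c x n (T.erase p) *
      (gPoly a b c (x j) (x j) / gPoly a b c (x p) (x j))) / (x j - x p) = 0 := by
  have hU : (T.erase p).card = 2 * n := by rw [Finset.card_erase_of_mem hp, hT]; rfl
  cases n with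
  | zero => rw [Finset.card_eq_zero.1 hU, Finset.sum_empty]
  | succ n =>
    set f : ι → ι → F := fun j l => (b ^ 2 - a * c) / (gPoly a b c (x p) (x l) *
      gPoly a b c (x j) (x l) * gPoly a b c (x p) (x j)) *
        recipHafnian a b c x n (((T.erase p).erase j).erase l) with hf
    have hfs : ∀ j l, f j l = f l j := by
      intro j l
      simp only [hf]
      rw [gPoly_comm a b c (x j) (x l), Finset.erase_right_comm (a := j)]
      ring
    have key : ∀ j ∈ T.erase p,
        (recipHafnian a b c x (n + 1) (T.erase j) - recipHafnian a b c x (n + 1) (T.erase p) *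
          (gPoly a b c (x j) (x j) / gPoly a b c (x p) (x j))) / (x j - x p) =
        ∑ l ∈ (T.erase p).erase j, x j * f j l - ∑ l ∈ (T.erase p).erase j, x l * f j l := by
      intro j hj
      have hjp := Finset.ne_of_mem_erase hj
      have hjT := Finset.mem_of_mem_erase hj
      rw [recipHafnian_succ a b c x n (T.erase p) hU j hj,
        recipHafnian_succ a b c x n (T.erase j) (by rw [Finset.card_erase_of_mem hjT, hT]; rfl) p
          (Finset.mem_erase.2 ⟨hjp.symm, hp⟩), Finset.erase_right_comm (a := j), Finset.sum_mul,
        ← Finset.sum_sub_distrib, ← Finset.sum_sub_distrib, Finset.sum_div]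
      refine Finset.sum_congr rfl fun l hl => ?_
      have hlj := Finset.ne_of_mem_erase hl
      have hlp := Finset.ne_of_mem_erase (Finset.mem_of_mem_erase hl)
      have h1 := hg p l hlp.symm
      have h2 := hg j l hlj.symm
      have h3 := hg p j hjp.symm
      have h4 := sub_ne_zero.2 (hx.ne hjp)
      simp only [hf]
      generalize recipHafnian a b c x n (((T.erase p).erase j).erase l) = Q
      have h5 : gPoly a b c (x j) (x l) * gPoly a b c (x p) (x j) -
          gPoly a b c (x j) (x j) * gPoly a b c (x p) (x l) =
            (b ^ 2 - a * c) * (x j - x p) * (x j - x l) := by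
        simp only [gPoly]; ring
      field_simp
      linear_combination Q * h5
    rw [Finset.sum_congr rfl key, Finset.sum_sub_distrib, sub_eq_zero]
    rw [Finset.sum_comm' (t' := T.erase p) (s' := fun l => (T.erase p).erase l)]
    · exact Finset.sum_congr rfl fun j _ => Finset.sum_congr rfl fun l _ => by rw [hfs]
    · intro j l
      simp only [Finset.mem_erase]
      grind

/-- Splitting off the factor at `p` turns the left side into minus the sum in
`sum_sq_mul_residueCoeff` over `T.erase p`. The right side comes from g(u,v)² - D (v - u)² = g(u,u)
g(v,v). -/
theorem sum_residueCoeff_mul_cotRatio (hx : Function.Injective x)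
    (hg : ∀ i j, i ≠ j → gPoly a b c (x i) (x j) ≠ 0) (n : ℕ) (T : Finset ι)
    (hT : T.card = 2 * n + 1) (p : ι) (hp : p ∈ T) :
    ∑ k ∈ T.erase p, residueCoeff (fun i j => cotRatio a b c (x i) (x j)) T k *
        cotRatio a b c (x p) (x k) =
      -(gPoly a b c (x p) (x p) * residueCoeff (fun i j => cotRatio a b c (x i) (x j)) T p *
        ∑ k ∈ T.erase p, gPoly a b c (x k) (x k) / gPoly a b c (x p) (x k) / (x k - x p)) := by
  have hU : (T.erase p).card = 2 * n := by rw [Finset.card_erase_of_mem hp, hT]; rfl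
  have hpU := Finset.notMem_erase p T
  have hne : ∀ k ∈ T.erase p, x k - x p ≠ 0 ∧ gPoly a b c (x p) (x k) ≠ 0 := fun k hk =>
    ⟨sub_ne_zero.2 (hx.ne (Finset.ne_of_mem_erase hk)), hg _ _ (Finset.ne_of_mem_erase hk).symm⟩
  have h := sum_sq_mul_residueCoeff (r := fun i j => cotRatio a b c (x i) (x j))
    (w := fun k => (x k - x p) / gPoly a b c (x p) (x k))
    (fun i j => cotRatio_antisymm a b c _ _) (cotLaw_cotRatio a b c x hx) (T.erase p)
    (cotLaw_cotRatio a b c x hx p _ hpU) (by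
      intro k hk
      obtain ⟨h1, h2⟩ := hne k hk
      simp only [cotRatio]
      field_simp)
  rw [hU, oddPow_even, mul_zero, zero_add] at h
  have h1 : residueCoeff (fun i j => cotRatio a b c (x i) (x j)) T p =
      ∏ k ∈ T.erase p, cotRatio a b c (x p) (x k) := rfl
  have h2 : ∀ k ∈ T.erase p, residueCoeff (fun i j => cotRatio a b c (x i) (x j)) T k *
      cotRatio a b c (x p) (x k) = -(cotRatio a b c (x p) (x k) ^ 2 *
        residueCoeff (fun i j => cotRatio a b c (x i) (x j)) (T.erase p) k) := by
    intro k hk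
    have := residueCoeff_insert_of_mem (r := fun i j => cotRatio a b c (x i) (x j)) hpU hk
    rw [Finset.insert_erase hp] at this
    rw [this, cotRatio_antisymm a b c (x k) (x p)]
    ring
  have h3 : ∀ k ∈ T.erase p, cotRatio a b c (x p) (x k) -
      (b ^ 2 - a * c) * ((x k - x p) / gPoly a b c (x p) (x k)) =
      gPoly a b c (x p) (x p) *
        (gPoly a b c (x k) (x k) / gPoly a b c (x p) (x k) / (x k - x p)) := by
    intro k hk
    obtain ⟨h1, h2⟩ := hne k hk
    simp only [cotRatio]
    field_simp
    simp only [gPoly]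
    ring
  rw [Finset.sum_congr rfl h2, Finset.sum_neg_distrib, h, Finset.sum_congr rfl h3,
    ← Finset.mul_sum, h1]
  ring

theorem sum_tanRatio_mul_residueCoeff (hx : Function.Injective x) (n : ℕ) (T : Finset ι)
    (hT : T.card = 2 * n + 1) (y : F) (hy : ∀ j, gPoly a b c y (x j) ≠ 0) :
    ∑ j ∈ T, (x j - y) / gPoly a b c y (x j) *
        residueCoeff (fun i j => cotRatio a b c (x i) (x j)) T j =
      (b ^ 2 - a * c) ^ (2 * n) * ∏ k ∈ T, (x k - y) / gPoly a b c y (x k) := by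
  rw [tan_prod_eq_sum (r := fun i j => cotRatio a b c (x i) (x j))
    (v := fun j => (x j - y) / gPoly a b c y (x j))
    (fun i j => cotRatio_antisymm a b c _ _) (cotLaw_cotRatio a b c x hx)
    (fun l j hlj => tanRatio_mul a b c (hy l) (hy j) (hx.ne hlj)) (2 * n) T hT, oddPow_even,
    add_zero]

theorem sum_tanRatio_mul_recipHafnian (hD : b ^ 2 - a * c ≠ 0) (hx : Function.Injective x)
    (hg : ∀ i j, i ≠ j → gPoly a b c (x i) (x j) ≠ 0) (n : ℕ) (T : Finset ι)
    (hT : T.card = 2 * n + 1) (y : F) (hy : ∀ j, gPoly a b c y (x j) ≠ 0) :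
    ∑ j ∈ T, (x j - y) / gPoly a b c y (x j) ^ 2 *
        (residueCoeff (fun i j => cotRatio a b c (x i) (x j)) T j *
          recipHafnian a b c x n (T.erase j)) =
      (b ^ 2 - a * c) ^ (2 * n) * (∏ k ∈ T, (x k - y) / gPoly a b c y (x k)) *
        ∑ j ∈ T, 1 / gPoly a b c y (x j) * recipHafnian a b c x n (T.erase j) := by
  rw [← sum_tanRatio_mul_residueCoeff a b c hx n T hT y hy, Finset.mul_sum]
  have hsplit : ∀ j ∈ T, (∑ k ∈ T, (x k - y) / gPoly a b c y (x k) *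
      residueCoeff (fun i j => cotRatio a b c (x i) (x j)) T k) *
        (1 / gPoly a b c y (x j) * recipHafnian a b c x n (T.erase j)) =
      (x j - y) / gPoly a b c y (x j) ^ 2 *
        (residueCoeff (fun i j => cotRatio a b c (x i) (x j)) T j *
          recipHafnian a b c x n (T.erase j)) +
      ∑ k ∈ T.erase j, (x k - y) / gPoly a b c y (x k) *
        residueCoeff (fun i j => cotRatio a b c (x i) (x j)) T k *
        (1 / gPoly a b c y (x j) * recipHafnian a b c x n (T.erase j)) := by
    intro j hj
    rw [← Finset.add_sum_erase _ _ hj, add_mul, Finset.sum_mul]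
    congr 1
    have := hy j
    field_simp
  rw [Finset.sum_congr rfl hsplit, Finset.sum_add_distrib, left_eq_add]
  -- Only the off-diagonal sum is left. The factor D makes its partial fractions in `y` free of
  -- denominators D.
  refine (mul_eq_zero.1 (?_ : (b ^ 2 - a * c) * _ = 0)).resolve_left hD
  have hsw : ∀ f : ι → ι → F, ∑ j ∈ T, ∑ k ∈ T.erase j, f j k = ∑ k ∈ T, ∑ j ∈ T.erase k, f j k :=
    fun f => Finset.sum_comm' fun j k => by simp only [Finset.mem_erase]; grind
  have key : ∀ j ∈ T, ∀ k ∈ T.erase j, (b ^ 2 - a * c) * ((x k - y) / gPoly a b c y (x k) *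
        residueCoeff (fun i j => cotRatio a b c (x i) (x j)) T k *
        (1 / gPoly a b c y (x j) * recipHafnian a b c x n (T.erase j))) =
      1 / gPoly a b c y (x k) * (gPoly a b c (x k) (x k) *
        residueCoeff (fun i j => cotRatio a b c (x i) (x j)) T k *
          (recipHafnian a b c x n (T.erase j) / (x j - x k))) +
      1 / gPoly a b c y (x j) * (recipHafnian a b c x n (T.erase j) *
        (residueCoeff (fun i j => cotRatio a b c (x i) (x j)) T k *
          cotRatio a b c (x j) (x k))) := by
    intro j hj k hk
    have h1 := sub_ne_zero.2 (hx.ne (Finset.ne_of_mem_erase hk))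
    have h2 := hy j
    have h3 := hy k
    have h4 : (b ^ 2 - a * c) * (x k - y) * (x k - x j) = gPoly a b c (x j) (x k) *
        gPoly a b c y (x k) - gPoly a b c (x k) (x k) * gPoly a b c y (x j) := by
      simp only [gPoly]; ring
    rw [cotRatio, ← neg_sub (x k) (x j), div_neg]
    generalize residueCoeff (fun i j => cotRatio a b c (x i) (x j)) T k = A
    generalize recipHafnian a b c x n (T.erase j) = H
    field_simp
    linear_combination A * H * h4
  simp only [Finset.mul_sum]
  rw [Finset.sum_congr rfl fun j hj => Finset.sum_congr rfl (key j hj)]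
  simp only [Finset.sum_add_distrib]
  -- Swapping the first double sum collects everything over the common pole 1 / g(y, x_p).
  rw [hsw, ← Finset.sum_add_distrib]
  refine Finset.sum_eq_zero fun p hp => ?_
  rw [← Finset.mul_sum, ← Finset.mul_sum, ← Finset.mul_sum, ← Finset.mul_sum,
    sum_residueCoeff_mul_cotRatio a b c hx hg n T hT p hp]
  have hC := sum_recipHafnian_erase a b c hx hg n T hT p hp
  simp only [sub_div, mul_div_assoc, Finset.sum_sub_distrib, ← Finset.mul_sum] at hC
  linear_combination 1 / gPoly a b c y (x p) * gPoly a b c (x p) (x p) *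
    residueCoeff (fun i j => cotRatio a b c (x i) (x j)) T p * hC

end Field

/-! ### Both identities at distinct points -/

section Generic

variable {F : Type*} [Field F] {a b c : F}

/-- This absorbs the sign of the first-row expansion: the factors lost on deleting `p` are the
reciprocals of those in the residue coefficient. -/
theorem neg_one_pow_mul_prod_prod_Ioi {m : ℕ} {x : Fin (m + 1) → F} (hx : Function.Injective x)
    (hg : ∀ i j, i ≠ j → gPoly a b c (x i) (x j) ≠ 0) (p : Fin (m + 1)) :
    (-1) ^ (p : ℕ) * ∏ i, ∏ k ∈ Finset.Ioi i, (x (p.succAbove k) - x (p.succAbove i)) /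
        gPoly a b c (x (p.succAbove i)) (x (p.succAbove k)) =
      residueCoeff (fun i j => cotRatio a b c (x i) (x j)) Finset.univ p *
        ∏ i, ∏ k ∈ Finset.Ioi i, (x k - x i) / gPoly a b c (x i) (x k) := by
  rw [prod_prod_Ioi_succAbove (fun i k => (x k - x i) / gPoly a b c (x i) (x k))
    (fun i j => by rw [gPoly_comm a b c (x i), ← neg_sub (x i), neg_div]) p]
  have h : residueCoeff (fun i j => cotRatio a b c (x i) (x j)) Finset.univ p *
      ∏ k ∈ Finset.univ.erase p, (x k - x p) / gPoly a b c (x p) (x k) = 1 := by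
    rw [residueCoeff, ← Finset.prod_mul_distrib]
    refine Finset.prod_eq_one fun k hk => ?_
    have h1 := sub_ne_zero.2 (hx.ne (Finset.ne_of_mem_erase hk))
    have h2 := hg p k (Finset.ne_of_mem_erase hk).symm
    rw [cotRatio]
    field_simp
  linear_combination (-(-1) ^ (p : ℕ) * ∏ i, ∏ k ∈ Finset.Ioi i,
    (x (p.succAbove k) - x (p.succAbove i)) /
      gPoly a b c (x (p.succAbove i)) (x (p.succAbove k))) * h

theorem prod_prod_Ioi_succ {M : Type*} [CommMonoid M] {m : ℕ} (s : Fin (m + 1) → Fin (m + 1) → M) :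
    ∏ i, ∏ k ∈ Finset.Ioi i, s i k =
      (∏ k : Fin m, s 0 k.succ) * ∏ i : Fin m, ∏ k ∈ Finset.Ioi i, s i.succ k.succ := by
  rw [Fin.prod_univ_succ]
  congr 1
  · rw [← Fin.prod_Ioi_zero]
  · exact Finset.prod_congr rfl fun i _ => Fin.prod_Ioi_succ (s i.succ) i

theorem prod_prod_Ioi_fin_zero {M : Type*} [CommMonoid M] (s : Fin (2 * 0) → Fin (2 * 0) → M) :
    ∏ i, ∏ k ∈ Finset.Ioi i, s i k = 1 :=
  Finset.prod_eq_one fun i _ => absurd i.isLt (by omega)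

theorem pfaffian_tanRatio_of_injective (n : ℕ) (x : Fin (2 * n) → F) (hx : Function.Injective x)
    (hg : ∀ i j, i ≠ j → gPoly a b c (x i) (x j) ≠ 0) :
    pfaffian (Matrix.of fun i j => (x j - x i) / gPoly a b c (x i) (x j)) =
      (b ^ 2 - a * c) ^ (n * (n - 1)) *
        ∏ i, ∏ j ∈ Finset.Ioi i, (x j - x i) / gPoly a b c (x i) (x j) := by
  induction n with
  | zero =>
    rw [pfaffian_zero, prod_prod_Ioi_fin_zero]
    simp
  | succ n ih =>
    set y : F := x (0 : Fin (2 * n + 1 + 1)) with hy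
    set z : Fin (2 * n + 1) → F := fun k => x (k.succ : Fin (2 * n + 1 + 1)) with hz
    have hzi : Function.Injective z := fun k l h => Fin.succ_injective _ (hx h)
    have hzg : ∀ i j, i ≠ j → gPoly a b c (z i) (z j) ≠ 0 := fun i j h =>
      hg _ _ ((Fin.succ_injective _).ne h)
    have hyz : ∀ j, gPoly a b c y (z j) ≠ 0 := fun j => hg _ _ (Fin.succ_ne_zero j).symm
    have hP := prod_prod_Ioi_succ (m := 2 * n + 1)
      fun i k => (x k - x i) / gPoly a b c (x i) (x k)
    have hexp := pfaffian_succ (n := n)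
      (Matrix.of fun i j => (x j - x i) / gPoly a b c (x i) (x j))
    have key : ∀ j : Fin (2 * n + 1), (-1) ^ (j : ℕ) * ((z j - y) / gPoly a b c y (z j)) *
        pfaffian (Matrix.of fun k l => (z (j.succAbove l) - z (j.succAbove k)) /
          gPoly a b c (z (j.succAbove k)) (z (j.succAbove l))) =
        (b ^ 2 - a * c) ^ (n * (n - 1)) *
          (∏ i, ∏ k ∈ Finset.Ioi i, (z k - z i) / gPoly a b c (z i) (z k)) *
          ((z j - y) / gPoly a b c y (z j) *
            residueCoeff (fun i j => cotRatio a b c (z i) (z j)) Finset.univ j) := by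
      intro j
      rw [ih (fun k => z (j.succAbove k)) (hzi.comp Fin.succAbove_right_injective)
        fun k l h => hzg _ _ (Fin.succAbove_right_injective.ne h)]
      linear_combination (b ^ 2 - a * c) ^ (n * (n - 1)) * ((z j - y) / gPoly a b c y (z j)) *
        neg_one_pow_mul_prod_prod_Ioi hzi hzg j
    refine hexp.trans ((Finset.sum_congr rfl fun j _ => key j).trans ?_)
    rw [← Finset.mul_sum, sum_tanRatio_mul_residueCoeff a b c hzi n Finset.univ (by simp) y hyz]
    refine Eq.trans ?_ (congrArg ((b ^ 2 - a * c) ^ ((n + 1) * (n + 1 - 1)) * ·) hP.symm)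
    have hpow : (n + 1) * (n + 1 - 1) = n * (n - 1) + 2 * n := by
      cases n with
      | zero => rfl
      | succ n => simp only [Nat.add_sub_cancel]; ring
    rw [hpow, pow_add]
    simp only [hy, hz]
    ring

theorem pfaffian_tanRatio_sq_of_injective (hD : b ^ 2 - a * c ≠ 0) (n : ℕ) (x : Fin (2 * n) → F)
    (hx : Function.Injective x) (hg : ∀ i j, i ≠ j → gPoly a b c (x i) (x j) ≠ 0) :
    pfaffian (Matrix.of fun i j => (x j - x i) / gPoly a b c (x i) (x j) ^ 2) =
      (b ^ 2 - a * c) ^ (n * (n - 1)) *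
        (∏ i, ∏ j ∈ Finset.Ioi i, (x j - x i) / gPoly a b c (x i) (x j)) *
        hafnian (Matrix.of fun i j => 1 / gPoly a b c (x i) (x j)) := by
  induction n with
  | zero =>
    rw [pfaffian_zero, prod_prod_Ioi_fin_zero, hafnian_zero]
    simp
  | succ n ih =>
    set y : F := x (0 : Fin (2 * n + 1 + 1)) with hy
    set z : Fin (2 * n + 1) → F := fun k => x (k.succ : Fin (2 * n + 1 + 1)) with hz
    have hzi : Function.Injective z := fun k l h => Fin.succ_injective _ (hx h)
    have hzg : ∀ i j, i ≠ j → gPoly a b c (z i) (z j) ≠ 0 := fun i j h =>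
      hg _ _ ((Fin.succ_injective _).ne h)
    have hyz : ∀ j, gPoly a b c y (z j) ≠ 0 := fun j => hg _ _ (Fin.succ_ne_zero j).symm
    have hP := prod_prod_Ioi_succ (m := 2 * n + 1)
      fun i k => (x k - x i) / gPoly a b c (x i) (x k)
    have hH : ∀ j : Fin (2 * n + 1), hafnian (Matrix.of fun k l =>
        1 / gPoly a b c (z (j.succAbove k)) (z (j.succAbove l))) =
          recipHafnian a b c z n (Finset.univ.erase j) := by
      intro j
      rw [hafnian_of_strictMono (fun i j => 1 / gPoly a b c (z i) (z j)) j.succAbove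
        (Fin.strictMono_succAbove j), Fin.image_succAbove_univ, Finset.compl_singleton]
      rfl
    have hexp := pfaffian_succ (n := n)
      (Matrix.of fun i j => (x j - x i) / gPoly a b c (x i) (x j) ^ 2)
    have hexp' : hafnian (n := n + 1) (Matrix.of fun i j => 1 / gPoly a b c (x i) (x j)) =
        ∑ j, 1 / gPoly a b c y (z j) * recipHafnian a b c z n (Finset.univ.erase j) :=
      (hafnian_succ _).trans (Finset.sum_congr rfl fun j _ =>
        congrArg (1 / gPoly a b c y (z j) * ·) (hH j))
    have key : ∀ j : Fin (2 * n + 1), (-1) ^ (j : ℕ) * ((z j - y) / gPoly a b c y (z j) ^ 2) *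
        pfaffian (Matrix.of fun k l => (z (j.succAbove l) - z (j.succAbove k)) /
          gPoly a b c (z (j.succAbove k)) (z (j.succAbove l)) ^ 2) =
        (b ^ 2 - a * c) ^ (n * (n - 1)) *
          (∏ i, ∏ k ∈ Finset.Ioi i, (z k - z i) / gPoly a b c (z i) (z k)) *
          ((z j - y) / gPoly a b c y (z j) ^ 2 *
            (residueCoeff (fun i j => cotRatio a b c (z i) (z j)) Finset.univ j *
              recipHafnian a b c z n (Finset.univ.erase j))) := by
      intro j
      rw [ih (fun k => z (j.succAbove k)) (hzi.comp Fin.succAbove_right_injective)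
        fun k l h => hzg _ _ (Fin.succAbove_right_injective.ne h), hH]
      linear_combination (b ^ 2 - a * c) ^ (n * (n - 1)) *
        ((z j - y) / gPoly a b c y (z j) ^ 2) *
          recipHafnian a b c z n (Finset.univ.erase j) * neg_one_pow_mul_prod_prod_Ioi hzi hzg j
    refine hexp.trans ((Finset.sum_congr rfl fun j _ => key j).trans ?_)
    rw [← Finset.mul_sum,
      sum_tanRatio_mul_recipHafnian a b c hD hzi hzg n Finset.univ (by simp) y hyz, hexp']
    refine Eq.trans ?_ (congrArg (fun t => (b ^ 2 - a * c) ^ ((n + 1) * (n + 1 - 1)) * t *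
      ∑ j, 1 / gPoly a b c y (z j) * recipHafnian a b c z n (Finset.univ.erase j)) hP.symm)
    have hpow : (n + 1) * (n + 1 - 1) = n * (n - 1) + 2 * n := by
      cases n with
      | zero => rfl
      | succ n => simp only [Nat.add_sub_cancel]; ring
    simp only [hpow, pow_add, hy, hz]
    ring

end Generic

/-! ### Deformation over power series and specialization -/

theorem map_gPoly {R S : Type*} [CommRing R] [CommRing S] (f : R →+* S) (a b c u v : R) :
    f (gPoly a b c u v) = gPoly (f a) (f b) (f c) (f u) (f v) := by
  simp [gPoly]

open PowerSeries in
-- The coefficient of X² is 1, in every characteristic.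
theorem powerSeries_discrim_ne_zero {K : Type*} [Field K] (a b c : K) :
    (C b + X : K⟦X⟧) ^ 2 - C a * C c ≠ 0 := by
  intro h
  have h2 : (C b + X : K⟦X⟧) ^ 2 - C a * C c = X ^ 2 + (C (2 * b) * X + C (b ^ 2 - a * c)) := by
    simp only [map_mul, map_sub, map_pow, map_ofNat]; ring
  rw [h2] at h
  have := congrArg (coeff 2) h
  rw [map_add, map_add, coeff_C_mul, coeff_X_pow, coeff_X, coeff_C] at this
  simp at this

open PowerSeries in
theorem powerSeries_perturb_injective {K : Type*} [Field K] {m : ℕ} (x : Fin m → K) :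
    Function.Injective fun i : Fin m => (C (x i) + X ^ ((i : ℕ) + 1) : K⟦X⟧) := by
  intro i j h
  by_contra hij
  have := congrArg (coeff ((i : ℕ) + 1)) h
  simp [coeff_X_pow, Fin.val_inj, hij] at this

open PowerSeries in
theorem theorem3 {K : Type*} [Field K] (a b c : K) (hg : a ≠ 0 ∨ b ≠ 0 ∨ c ≠ 0)
    (n : ℕ) (x : Fin (2 * n) → K) (hx : ∀ i j : Fin (2 * n), i < j → gPoly a b c (x i) (x j) ≠ 0) :
    pfaffian (Matrix.of fun i j : Fin (2 * n) => (x j - x i) / gPoly a b c (x i) (x j)) =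
        (b ^ 2 - a * c) ^ (n * (n - 1)) *
          ∏ i : Fin (2 * n), ∏ j ∈ Finset.Ioi i, (x j - x i) / gPoly a b c (x i) (x j) ∧
      pfaffian (Matrix.of fun i j : Fin (2 * n) => (x j - x i) / gPoly a b c (x i) (x j) ^ 2) =
        (b ^ 2 - a * c) ^ (n * (n - 1)) *
          (∏ i : Fin (2 * n), ∏ j ∈ Finset.Ioi i, (x j - x i) / gPoly a b c (x i) (x j)) *
          hafnian (Matrix.of fun i j : Fin (2 * n) => 1 / gPoly a b c (x i) (x j)) := by
  -- Distinct positive powers of X separate points that may coincide, and b + X makes the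
  -- discriminant nonzero. Modulo X the original data return.
  set x' : Fin (2 * n) → K⟦X⟧ := fun i => C (x i) + X ^ ((i : ℕ) + 1) with hx'
  set G : Fin (2 * n) → Fin (2 * n) → K⟦X⟧ := fun i j =>
    gPoly (C a) (C b + X) (C c) (x' i) (x' j) with hG
  have hx0 : ∀ i, constantCoeff (x' i) = x i := fun i => by simp [hx']
  have hG0 : ∀ i j, constantCoeff (G i j) = gPoly a b c (x i) (x j) := fun i j => by
    simp only [hG]
    rw [map_gPoly]
    simp [hx0]
  have hne : ∀ i j, i ≠ j → constantCoeff (G i j) ≠ 0 := by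
    intro i j hij
    rw [hG0]
    rcases lt_or_gt_of_ne hij with h | h
    · exact hx i j h
    · rw [gPoly_comm]
      exact hx j i h
  set ψ := algebraMap K⟦X⟧ (FractionRing K⟦X⟧) with hψ
  have hψi : Function.Injective ψ := IsFractionRing.injective _ _
  have hψG : ∀ i j, ψ (G i j) = gPoly (ψ (C a)) (ψ (C b + X)) (ψ (C c)) (ψ (x' i)) (ψ (x' j)) :=
    fun i j => map_gPoly ψ _ _ _ _ _
  -- Off the diagonal `G i j` is a unit of K⟦X⟧, so the entries already live there; the identities
  -- are proved in the fraction field and pulled back along the injection `ψ`.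
  have hψinv : ∀ i j, i ≠ j → ψ (G i j)⁻¹ = (ψ (G i j))⁻¹ := fun i j hij =>
    eq_inv_of_mul_eq_one_left (by rw [← map_mul, PowerSeries.inv_mul_cancel _ (hne i j hij), map_one])
  have hgen : ∀ i j, i ≠ j →
      gPoly (ψ (C a)) (ψ (C b + X)) (ψ (C c)) (ψ (x' i)) (ψ (x' j)) ≠ 0 := by
    intro i j hij
    rw [← hψG, map_ne_zero_iff _ hψi]
    exact fun h => hne i j hij (by rw [h, map_zero])
  have hinj : Function.Injective fun i => ψ (x' i) :=
    hψi.comp (powerSeries_perturb_injective x)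
  have hD : ψ (C b + X) ^ 2 - ψ (C a) * ψ (C c) ≠ 0 := by
    rw [← map_pow, ← map_mul, ← map_sub, map_ne_zero_iff _ hψi]
    exact powerSeries_discrim_ne_zero a b c
  have e1 : ∀ i j, i < j → ψ ((x' j - x' i) * (G i j)⁻¹) = (ψ (x' j) - ψ (x' i)) /
      gPoly (ψ (C a)) (ψ (C b + X)) (ψ (C c)) (ψ (x' i)) (ψ (x' j)) := fun i j hij => by
    rw [map_mul, map_sub, hψinv i j hij.ne, hψG, div_eq_mul_inv]
  have e2 : ∀ i j, i < j → ψ ((x' j - x' i) * (G i j)⁻¹ ^ 2) = (ψ (x' j) - ψ (x' i)) /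
      gPoly (ψ (C a)) (ψ (C b + X)) (ψ (C c)) (ψ (x' i)) (ψ (x' j)) ^ 2 := fun i j hij => by
    rw [map_mul, map_sub, map_pow, hψinv i j hij.ne, hψG, div_eq_mul_inv, inv_pow]
  have e3 : ∀ i j, i < j → ψ (G i j)⁻¹ = 1 /
      gPoly (ψ (C a)) (ψ (C b + X)) (ψ (C c)) (ψ (x' i)) (ψ (x' j)) := fun i j hij => by
    rw [hψinv i j hij.ne, hψG, one_div]
  have eP : ψ (∏ i, ∏ j ∈ Finset.Ioi i, (x' j - x' i) * (G i j)⁻¹) =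
      ∏ i, ∏ j ∈ Finset.Ioi i, (ψ (x' j) - ψ (x' i)) /
        gPoly (ψ (C a)) (ψ (C b + X)) (ψ (C c)) (ψ (x' i)) (ψ (x' j)) := by
    rw [map_prod]
    refine Finset.prod_congr rfl fun i _ => ?_
    rw [map_prod]
    exact Finset.prod_congr rfl fun j hj => e1 i j (Finset.mem_Ioi.1 hj)
  have c1 : ∀ i j, constantCoeff ((x' j - x' i) * (G i j)⁻¹) =
      (x j - x i) / gPoly a b c (x i) (x j) := fun i j => by
    rw [map_mul, map_sub, constantCoeff_inv, hx0, hx0, hG0, div_eq_mul_inv]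
  have c2 : ∀ i j, constantCoeff ((x' j - x' i) * (G i j)⁻¹ ^ 2) =
      (x j - x i) / gPoly a b c (x i) (x j) ^ 2 := fun i j => by
    rw [map_mul, map_sub, map_pow, constantCoeff_inv, hx0, hx0, hG0, div_eq_mul_inv, inv_pow]
  have c3 : ∀ i j, constantCoeff (G i j)⁻¹ = 1 / gPoly a b c (x i) (x j) := fun i j => by
    rw [constantCoeff_inv, hG0, one_div]
  have hlift1 : pfaffian (Matrix.of fun i j => (x' j - x' i) * (G i j)⁻¹) =
      ((C b + X) ^ 2 - C a * C c) ^ (n * (n - 1)) *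
        ∏ i, ∏ j ∈ Finset.Ioi i, (x' j - x' i) * (G i j)⁻¹ := by
    apply hψi
    refine (map_pfaffian ψ _).trans ((pfaffian_congr e1).trans ?_)
    rw [map_mul, eP]
    simp only [map_pow, map_sub, map_mul]
    exact pfaffian_tanRatio_of_injective n _ hinj hgen
  have hlift2 : pfaffian (Matrix.of fun i j => (x' j - x' i) * (G i j)⁻¹ ^ 2) =
      ((C b + X) ^ 2 - C a * C c) ^ (n * (n - 1)) *
        (∏ i, ∏ j ∈ Finset.Ioi i, (x' j - x' i) * (G i j)⁻¹) *
        hafnian (Matrix.of fun i j => (G i j)⁻¹) := by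
    apply hψi
    have eH : ψ (hafnian (Matrix.of fun i j => (G i j)⁻¹)) = hafnian (Matrix.of fun i j => 1 /
        gPoly (ψ (C a)) (ψ (C b + X)) (ψ (C c)) (ψ (x' i)) (ψ (x' j))) :=
      (map_hafnian ψ _).trans (hafnian_congr e3)
    refine (map_pfaffian ψ _).trans ((pfaffian_congr e2).trans ?_)
    rw [map_mul, map_mul, eP, eH]
    simp only [map_pow, map_sub, map_mul]
    exact pfaffian_tanRatio_sq_of_injective hD n _ hinj hgen
  have hm : ∀ f : Fin (2 * n) → Fin (2 * n) → K⟦X⟧, (Matrix.of f).map (constantCoeff (R := K)) =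
      Matrix.of fun i j => constantCoeff (f i j) := fun _ => rfl
  constructor
  · have h := congrArg (constantCoeff (R := K)) hlift1
    rw [map_pfaffian, hm] at h
    simpa only [map_mul, map_pow, map_sub, map_add, map_prod, c1, constantCoeff_C,
      constantCoeff_X, add_zero] using h
  · have h := congrArg (constantCoeff (R := K)) hlift2
    rw [map_pfaffian, map_mul, map_hafnian, hm, hm] at h
    simp only [c2, c3] at h
    rw [h, map_mul, map_prod]
    simp only [map_prod, c1]
    simp
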